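/- Let $X$ be a real or complex Banach space. Let $(y_n)_{n=1}^\infty$ be a bounded, non-convergent sequence in $X$ such that for every $k\in\mathbb N$ and all scalars $\alpha^1,\dots,\alpha^k$ the limit $$L(\alpha^1,\dots,\alpha^k,0,0,\dots)=\lim_{\substack{n_1<\dots<n_k\\ n_1\to\infty}}\Big\|\sum_{i=1}^k\alpha^i y_{n_i}\Big\|$$ exists. Then $L$ is a norm on the space $c_{00}$ of finitely supported scalar sequences, and the completion of $(c_{00},L)$ is called a \emph{spreading model} of $X$. For a norm $|||\cdot|||$ on $X$, the \emph{symmetric Kottman constant} $K^s(X,|||\cdot|||)$ is the supremum of all $\sigma>0$ for which there is a sequence $(x_n)_{n=1}^\infty$ in $X$ with $|||x_n|||\le 1$ for all $n$ and $|||x_n+x_k|||\ge\sigma$ and $|||x_n-x_k|||\ge\sigma$ for all $n\ne k$. \textbf{Corollary.} Suppose that a Banach space $X$ admits a spreading model that is isomorphic (linearly homeomorphic) to $\ell_1$. Then for every norm $|||\cdot|||$ on $X$ that is equivalent to the original norm one has $K^s(X,|||\cdot|||)=2$. -/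

import Mathlib

open Filter Topology

/-- The filter on `k`-tuples of indices along which one takes the limit
`n₁ < ⋯ < nₖ`, `n₁ → ∞`. -/
def spreadFilter (k : ℕ) : Filter (Fin k → ℕ) :=
  atTop ⊓ 𝓟 {n | StrictMono n}

/-- The Banach space `F` is a spreading model of `X`, generated by the sequence `y` in `X`, with
fundamental sequence `e`. The sequence `y` is bounded and not norm convergent, and for all
scalars `α₁, …, αₖ` the limit `L(α) = lim ‖∑ αᵢ y_{nᵢ}‖` along `n₁ < ⋯ < nₖ`, `n₁ → ∞`, exists.
The map `α ↦ ∑ αᵢ eᵢ` embeds `c₀₀` with the norm `L` isometrically onto a dense subspace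
of `F`. As `F` is complete, this says that `F` is the completion of `(c₀₀, L)` and that `e` is the
image of the canonical basis. -/
structure IsSpreadingModelOf (𝕜 : Type*) [RCLike 𝕜]
    {X : Type*} [NormedAddCommGroup X] [NormedSpace 𝕜 X]
    {F : Type*} [NormedAddCommGroup F] [NormedSpace 𝕜 F] [CompleteSpace F]
    (y : ℕ → X) (e : ℕ → F) : Prop where
  isBounded : Bornology.IsBounded (Set.range y)
  not_convergent : ¬ ∃ x : X, Tendsto y atTop (𝓝 x)
  tendsto_norm : ∀ (k : ℕ) (α : Fin k → 𝕜),
    Tendsto (fun n : Fin k → ℕ => ‖∑ i, α i • y (n i)‖) (spreadFilter k)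
      (𝓝 ‖∑ i : Fin k, α i • e i‖)
  dense_span : Dense (Submodule.span 𝕜 (Set.range e) : Set F)

/-- The Banach space `F` is a spreading model of `X`. -/
def IsSpreadingModel (𝕜 : Type*) [RCLike 𝕜]
    (X : Type*) [NormedAddCommGroup X] [NormedSpace 𝕜 X]
    (F : Type*) [NormedAddCommGroup F] [NormedSpace 𝕜 F] [CompleteSpace F] : Prop :=
  ∃ (y : ℕ → X) (e : ℕ → F), IsSpreadingModelOf 𝕜 y e

/-- `N` is a norm on the vector space `X` equivalent to the given norm of `X` (a renorming). -/
def IsRenorming {𝕜 : Type*} [RCLike 𝕜] {X : Type*} [NormedAddCommGroup X] [NormedSpace 𝕜 X]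
    (N : Seminorm 𝕜 X) : Prop :=
  ∃ c C : ℝ, 0 < c ∧ 0 < C ∧ ∀ x : X, c * ‖x‖ ≤ N x ∧ N x ≤ C * ‖x‖

/-- The symmetric Kottman constant of the space `(X, N)`: the supremum of all `σ > 0` for which
the unit ball contains a symmetrically `σ`-separated sequence. The set of such `σ` is bounded
above by `2`; if it is empty, the value is `0`. -/
noncomputable def symmKottmanConstant {𝕜 : Type*} [RCLike 𝕜]
    {X : Type*} [AddCommGroup X] [Module 𝕜 X] (N : Seminorm 𝕜 X) : ℝ :=
  sSup {σ : ℝ | 0 < σ ∧ ∃ x : ℕ → X, (∀ n, N (x n) ≤ 1) ∧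
    ∀ n k, n ≠ k → σ ≤ N (x n + x k) ∧ σ ≤ N (x n - x k)}

/-! The fundamental sequence `e` is spreading, and a gliding hump in `ℓ₁` shows that it dominates
the `ℓ₁` basis. Hence, for any renorming `N`, the sequence `y` has a positive asymptotic lower
`ℓ₁`-constant; let `δ` be the supremum of these constants. If `t < δ < s` with `t` admissible, then
`s` fails on one coefficient vector along arbitrarily late blocks of `y`, while sums and differences
of two successive such blocks obey the bound for `t`. Normalised, these blocks are symmetrically
`2t/s`-separated, and `t/s` can be taken close to 1. No limit along `y` is needed for `N` itself. -/

lemma eventually_spreadFilter {k : ℕ} {p : (Fin k → ℕ) → Prop} :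
    (∀ᶠ n in spreadFilter k, p n) ↔ ∃ P : ℕ, ∀ n, StrictMono n → (∀ i, P ≤ n i) → p n := by
  rw [spreadFilter, eventually_inf_principal, eventually_atTop]
  constructor
  · rintro ⟨a, ha⟩
    exact ⟨∑ i, a i, fun n hn h => ha n
      (fun i => (Finset.single_le_sum (f := a) (fun _ _ => Nat.zero_le _)
        (Finset.mem_univ i)).trans (h i)) hn⟩
  · rintro ⟨P, hP⟩
    exact ⟨fun _ => P, fun n h hn => hP n hn h⟩

instance spreadFilter_neBot (k : ℕ) : (spreadFilter k).NeBot := by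
  refine Filter.neBot_iff.2 fun h => ?_
  obtain ⟨P, hP⟩ := eventually_spreadFilter.1 (Filter.eventually_false_iff_eq_bot.2 h)
  exact hP (fun i => P + i) (fun i j h => Nat.add_lt_add_left h P) fun i => Nat.le_add_right _ _

lemma tendsto_comp_spreadFilter {k K : ℕ} {m : Fin k → Fin K} (hm : StrictMono m) :
    Tendsto (fun n : Fin K → ℕ => n ∘ m) (spreadFilter K) (spreadFilter k) := by
  intro s hs
  obtain ⟨P, hP⟩ := eventually_spreadFilter.1 hs
  exact eventually_spreadFilter.2 ⟨P, fun n hn h => hP _ (hn.comp hm) fun i => h _⟩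

lemma sum_extend_smul {R V ι κ : Type*} [Semiring R] [AddCommMonoid V] [Module R V] [Fintype ι]
    [Fintype κ] [DecidableEq κ] (α : ι → R) (m : ι → κ) (v : κ → V) :
    ∑ j, (∑ i, if m i = j then α i else 0) • v j = ∑ i, α i • v (m i) := by
  simp only [Finset.sum_smul]
  rw [Finset.sum_comm]
  refine Finset.sum_congr rfl fun i _ => ?_
  simp [ite_smul]

section LittleL1

variable {𝕜 : Type*} [RCLike 𝕜]

lemma lp_one_hasSum_norm (x : lp (fun _ : ℕ => 𝕜) 1) : HasSum (fun i => ‖x i‖) ‖x‖ := by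
  simpa using lp.hasSum_norm (p := 1) (by simp) x

/-- Adding a coordinatewise null sequence in `ℓ₁` is asymptotically additive on norms. -/
lemma eventually_norm_add_norm_sub_le {G : ℕ → lp (fun _ : ℕ => 𝕜) 1}
    (hG : ∀ i, Tendsto (fun j => G j i) atTop (𝓝 0)) (x : lp (fun _ : ℕ => 𝕜) 1) {ε : ℝ}
    (hε : 0 < ε) : ∀ᶠ j in atTop, ‖x‖ + ‖G j‖ - ε ≤ ‖x + G j‖ := by
  have hx := lp_one_hasSum_norm x
  -- Twice this sum bounds the defect in the triangle inequality, and `x` dominates it.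
  have hmin : Tendsto (fun j => ∑' i, min ‖x i‖ ‖G j i‖) atTop (𝓝 (∑' _ : ℕ, (0 : ℝ))) := by
    refine tendsto_tsum_of_dominated_convergence hx.summable (fun i => ?_)
      (Eventually.of_forall fun j i => ?_)
    · have := (tendsto_const_nhds (x := ‖x i‖)).min (hG i).norm
      simpa using this
    · rw [Real.norm_of_nonneg (le_min (norm_nonneg _) (norm_nonneg _))]
      exact min_le_left _ _
  rw [tsum_zero] at hmin
  filter_upwards [hmin.eventually (gt_mem_nhds (half_pos hε))] with j hj
  have hg := lp_one_hasSum_norm (G j)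
  have hs : Summable fun i => min ‖x i‖ ‖G j i‖ :=
    Summable.of_nonneg_of_le (fun i => le_min (norm_nonneg _) (norm_nonneg _))
      (fun i => min_le_left _ _) hx.summable
  have := hasSum_le (fun i => ?_) ((hx.add hg).sub (hs.hasSum.mul_left 2))
    (lp_one_hasSum_norm (x + G j))
  · linarith
  · have h1 := norm_sub_le (x i + G j i) (G j i)
    have h2 := norm_sub_le (x i + G j i) (x i)
    rw [add_sub_cancel_right] at h1
    rw [add_sub_cancel_left] at h2
    change ‖x i‖ + ‖G j i‖ - 2 * min ‖x i‖ ‖G j i‖ ≤ ‖x i + G j i‖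
    rcases min_choice ‖x i‖ ‖G j i‖ with h | h <;> rw [h] <;> linarith

/-- Gliding hump: each new term is chosen so late that it is almost disjoint from the sum so far. -/
lemma exists_strictMono_le_norm_sum {G : ℕ → lp (fun _ : ℕ => 𝕜) 1}
    (hG : ∀ i, Tendsto (fun j => G j i) atTop (𝓝 0)) {a : ℝ} (ha : ∀ j, a ≤ ‖G j‖) {k : ℕ}
    (α : Fin k → 𝕜) {ε : ℝ} (hε : 0 < ε) :
    ∃ m : Fin k → ℕ, StrictMono m ∧ a * ∑ i, ‖α i‖ ≤ ‖∑ i, α i • G (m i)‖ + ε := by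
  induction k generalizing ε with
  | zero => exact ⟨fun _ => 0, Subsingleton.strictMono _, by simpa using hε.le⟩
  | succ k ih =>
    obtain ⟨m, hm, hle⟩ := ih (fun i => α i.castSucc) (half_pos hε)
    have hβ : ∀ i, Tendsto (fun j => (α (Fin.last k) • G j) i) atTop (𝓝 0) := fun i => by
      simpa using (hG i).const_mul (α (Fin.last k))
    obtain ⟨j, hj, hmj⟩ := ((eventually_norm_add_norm_sub_le hβ
      (∑ i, α i.castSucc • G (m i)) (half_pos hε)).and (eventually_gt_atTop (∑ i, m i))).exists
    refine ⟨Fin.snoc m j, ?_, ?_⟩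
    · intro p q
      refine Fin.lastCases ?_ (fun q => ?_) q
      · refine Fin.lastCases (fun h => (lt_irrefl _ h).elim) (fun p _ => ?_) p
        simpa using (Finset.single_le_sum (f := m) (fun _ _ => Nat.zero_le _)
          (Finset.mem_univ p)).trans_lt hmj
      · refine Fin.lastCases (fun h => ?_) (fun p h => ?_) p
        · exact (h.not_ge (Fin.le_last _)).elim
        · simpa using hm (by simpa using h)
    · simp only [Fin.sum_univ_castSucc, Fin.snoc_castSucc, Fin.snoc_last]
      rw [norm_smul] at hj
      have := mul_le_mul_of_nonneg_left (ha j) (norm_nonneg (α (Fin.last k)))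
      linarith

end LittleL1

namespace IsSpreadingModelOf

variable {𝕜 : Type*} [RCLike 𝕜] {X : Type*} [NormedAddCommGroup X] [NormedSpace 𝕜 X]
  {F : Type*} [NormedAddCommGroup F] [NormedSpace 𝕜 F] [CompleteSpace F] {y : ℕ → X} {e : ℕ → F}

/-- The fundamental sequence of a spreading model is spreading. -/
lemma norm_sum_comp (h : IsSpreadingModelOf 𝕜 y e) {k : ℕ} (α : Fin k → 𝕜) {m : Fin k → ℕ}
    (hm : StrictMono m) : ‖∑ i, α i • e (m i)‖ = ‖∑ i, α i • e i‖ := by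
  obtain ⟨K, hK⟩ : ∃ K, ∀ i, m i < K :=
    ⟨∑ i, m i + 1, fun i => Nat.lt_succ_of_le
      (Finset.single_le_sum (f := m) (fun _ _ => Nat.zero_le _) (Finset.mem_univ i))⟩
  let m' : Fin k → Fin K := fun i => ⟨m i, hK i⟩
  have hm' : StrictMono m' := fun i j hij => hm hij
  let β : Fin K → 𝕜 := fun j => ∑ i, if m' i = j then α i else 0
  have h1 := h.tendsto_norm K β
  have h2 := (h.tendsto_norm k α).comp (tendsto_comp_spreadFilter hm')
  have h3 : (fun n : Fin K → ℕ => ‖∑ j, β j • y (n j)‖) =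
      (fun n : Fin k → ℕ => ‖∑ i, α i • y (n i)‖) ∘ fun n : Fin K → ℕ => n ∘ m' := by
    funext n
    simp [β, sum_extend_smul α m' fun j => y (n j)]
  rw [h3] at h1
  have := tendsto_nhds_unique h1 h2
  rw [← this]
  exact congrArg _ (sum_extend_smul α m' fun j : Fin K => e j).symm

lemma norm_sub_eq (h : IsSpreadingModelOf 𝕜 y e) {p q : ℕ} (hpq : p < q) :
    ‖e p - e q‖ = ‖e 0 - e 1‖ := by
  have := h.norm_sum_comp ![1, -1] (m := ![p, q]) (by
    intro i j hij
    fin_cases i <;> fin_cases j <;> simp_all)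
  simpa [Fin.sum_univ_two, sub_eq_add_neg] using this

/-- If this distance vanished, `y` would be Cauchy, hence convergent. -/
lemma norm_sub_pos [CompleteSpace X] (h : IsSpreadingModelOf 𝕜 y e) : 0 < ‖e 0 - e 1‖ := by
  refine (norm_nonneg _).lt_of_ne fun h0 => h.not_convergent ?_
  have h1 := h.tendsto_norm 2 ![1, -1]
  simp only [Fin.sum_univ_two, Matrix.cons_val_zero, Matrix.cons_val_one, one_smul, neg_smul,
    ← sub_eq_add_neg, Fin.val_zero, Fin.val_one, ← h0] at h1
  refine cauchySeq_tendsto_of_complete (Metric.cauchySeq_iff'.2 fun ε hε => ?_)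
  obtain ⟨P, hP⟩ := eventually_spreadFilter.1 (h1.eventually (gt_mem_nhds hε))
  refine ⟨P, fun n hn => ?_⟩
  rcases hn.eq_or_lt with rfl | hn
  · simpa using hε
  · have := hP ![P, n] (by intro i j hij; fin_cases i <;> fin_cases j <;> simp_all)
      (by intro i; fin_cases i <;> simp [hn.le])
    rw [dist_comm, dist_eq_norm]
    simpa using this

/-- The fundamental sequence of a spreading model isomorphic to `ℓ₁` dominates the unit vector
basis of `ℓ₁`. -/
lemma exists_lower_estimate [CompleteSpace X] (h : IsSpreadingModelOf 𝕜 y e)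
    (T : F ≃L[𝕜] lp (fun _ : ℕ => 𝕜) 1) :
    ∃ δ > 0, ∀ (k : ℕ) (α : Fin k → 𝕜), δ * ∑ i, ‖α i‖ ≤ ‖∑ i, α i • e i‖ := by
  obtain ⟨C, hC, hT⟩ := T.toContinuousLinearMap.bound
  obtain ⟨D, hD, hT'⟩ := T.symm.toContinuousLinearMap.bound
  have hbd : ∀ n, ‖e n‖ = ‖e 0‖ := fun n => by
    simpa using h.norm_sum_comp (fun _ : Fin 1 => (1 : 𝕜)) (m := fun _ => n)
      (Subsingleton.strictMono _)
  have hmem : ∀ n, (fun i => T (e n) i) ∈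
      Set.pi Set.univ fun _ : ℕ => Metric.closedBall (0 : 𝕜) (C * ‖e 0‖) := by
    intro n i _
    rw [mem_closedBall_zero_iff]
    refine (lp.norm_apply_le_norm one_ne_zero (T (e n)) i).trans ?_
    simpa [hbd n] using hT (e n)
  obtain ⟨u, -, φ, hφ, hu⟩ := (isCompact_univ_pi fun _ : ℕ =>
    isCompact_closedBall (0 : 𝕜) (C * ‖e 0‖)).tendsto_subseq hmem
  rw [tendsto_pi_nhds] at hu
  -- The coordinatewise limit `u` need not vanish; differences cancel it.
  set G : ℕ → lp (fun _ : ℕ => 𝕜) 1 := fun j => T (e (φ (2 * j)) - e (φ (2 * j + 1))) with hG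
  have hG0 : ∀ i, Tendsto (fun j => G j i) atTop (𝓝 0) := by
    intro i
    have h1 := (hu i).comp (StrictMono.tendsto_atTop (φ := fun j : ℕ => 2 * j)
      fun a b hab => by dsimp only; omega)
    have h2 := (hu i).comp (StrictMono.tendsto_atTop (φ := fun j : ℕ => 2 * j + 1)
      fun a b hab => by dsimp only; omega)
    have := h1.sub h2
    rw [sub_self] at this
    refine this.congr fun j => ?_
    simp [hG]
  have hGa : ∀ j, ‖e 0 - e 1‖ / D ≤ ‖G j‖ := by
    intro j
    rw [div_le_iff₀' hD, ← h.norm_sub_eq (hφ (Nat.lt_succ_self (2 * j)))]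
    simpa [hG] using hT' (G j)
  -- The factor 2 is the cost of splitting the differences into two copies of the same combination
  -- of `e`, equal in norm by spreading.
  refine ⟨‖e 0 - e 1‖ / D / (2 * C), div_pos (div_pos h.norm_sub_pos hD) (by positivity), ?_⟩
  intro k α
  refine le_of_forall_pos_le_add fun ε hε => ?_
  obtain ⟨m, hm, hmle⟩ := exists_strictMono_le_norm_sum hG0 hGa α
    (ε := 2 * C * ε) (by positivity)
  have h1 : ∑ i, α i • G (m i) =
      T (∑ i, α i • e (φ (2 * m i)) - ∑ i, α i • e (φ (2 * m i + 1))) := by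
    simp [hG, smul_sub]
  have h2 := h.norm_sum_comp α (m := fun i => φ (2 * m i))
    fun i j hij => hφ (by have := hm hij; omega)
  have h3 := h.norm_sum_comp α (m := fun i => φ (2 * m i + 1))
    fun i j hij => hφ (by have := hm hij; omega)
  have h4 : ‖∑ i, α i • G (m i)‖ ≤ C * (2 * ‖∑ i, α i • e i‖) := by
    rw [h1]
    refine (hT _).trans (mul_le_mul_of_nonneg_left ?_ hC.le)
    refine (norm_sub_le _ _).trans ?_
    rw [h2, h3, two_mul]
  rw [div_mul_eq_mul_div, div_le_iff₀ (by positivity)]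
  linarith

end IsSpreadingModelOf

section Blocks

variable {𝕜 : Type*} [RCLike 𝕜] {X : Type*} [AddCommGroup X] [Module 𝕜 X]

/-- `t` is an asymptotic lower `ℓ₁`-constant of the sequence `y` with respect to `N`. -/
def IsLowerSpreadConstant (N : Seminorm 𝕜 X) (y : ℕ → X) (t : ℝ) : Prop :=
  ∀ (k : ℕ) (α : Fin k → 𝕜),
    ∀ᶠ n in spreadFilter k, t * ∑ i, ‖α i‖ ≤ N (∑ i, α i • y (n i))

/-- James' blocking argument for pairs of blocks. -/
lemma exists_separated_of_isLowerSpreadConstant {N : Seminorm 𝕜 X} {y : ℕ → X} {s t : ℝ}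
    (hs : 0 < s) (ht : IsLowerSpreadConstant N y t) (hns : ¬ IsLowerSpreadConstant N y s) :
    ∃ x : ℕ → X, (∀ n, N (x n) ≤ 1) ∧
      ∀ n k, n ≠ k → 2 * t / s ≤ N (x n + x k) ∧ 2 * t / s ≤ N (x n - x k) := by
  simp only [IsLowerSpreadConstant, not_forall, eventually_spreadFilter, not_exists] at hns
  obtain ⟨k, α, hα⟩ := hns
  choose ν hν hνp hνN using hα
  have hlt : ∀ p, N (∑ i, α i • y (ν p i)) < s * ∑ i, ‖α i‖ := fun p => not_le.1 (hνN p)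
  have hA : 0 < ∑ i, ‖α i‖ := pos_of_mul_pos_right ((apply_nonneg N _).trans_lt (hlt 0)) hs.le
  set A := ∑ i, ‖α i‖ with hAdef
  obtain ⟨P, hP⟩ := eventually_spreadFilter.1
    ((ht (k + k) (Fin.append α α)).and (ht (k + k) (Fin.append α (-α))))
  -- Each threshold exceeds every index of the preceding block, so the blocks are successive.
  let p : ℕ → ℕ := fun j => Nat.rec P (fun _ q => q + ∑ i, ν q i + 1) j
  have hp : ∀ j, p (j + 1) = p j + ∑ i, ν (p j) i + 1 := fun j => rfl
  have hpm : Monotone p := monotone_nat_of_le_succ fun j => by rw [hp]; omega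
  have hpP : ∀ j, P ≤ p j := fun j => hpm (Nat.zero_le j)
  let z : ℕ → X := fun j => ∑ i, α i • y (ν (p j) i)
  have hz : ∀ i j, i < j → 2 * t * A ≤ N (z i + z j) ∧ 2 * t * A ≤ N (z i - z j) := by
    intro i j hij
    have hsep : ∀ a b, ν (p i) a < ν (p j) b := fun a b => by
      have h1 := Finset.single_le_sum (f := ν (p i)) (fun _ _ => Nat.zero_le _)
        (Finset.mem_univ a)
      have h2 := hpm (Nat.succ_le_of_lt hij)
      rw [Nat.succ_eq_add_one, hp] at h2
      have h3 := hνp (p j) b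
      omega
    have := hP (Fin.append (ν (p i)) (ν (p j))) ?_ ?_
    · simp only [Fin.sum_univ_add, Fin.append_left, Fin.append_right, Pi.neg_apply, norm_neg,
        neg_smul, Finset.sum_neg_distrib, ← sub_eq_add_neg, ← hAdef] at this
      exact ⟨by linarith [this.1], by linarith [this.2]⟩
    · intro a b
      refine Fin.addCases (fun a => ?_) (fun a => ?_) a <;>
        refine Fin.addCases (fun b => ?_) (fun b => ?_) b <;> intro h <;>
        simp only [Fin.append_left, Fin.append_right]
      · exact hν (p i) h
      · exact hsep a b
      · simp only [Fin.lt_def, Fin.val_natAdd, Fin.val_castAdd] at h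
        omega
      · simp only [Fin.lt_def, Fin.val_natAdd] at h
        exact hν (p j) (Fin.lt_def.2 (by omega))
    · intro a
      refine Fin.addCases (fun a => ?_) (fun a => ?_) a
      · simpa only [Fin.append_left] using (hpP i).trans (hνp (p i) a)
      · simpa only [Fin.append_right] using (hpP j).trans (hνp (p j) a)
  have hz' : ∀ i j, i ≠ j → 2 * t * A ≤ N (z i + z j) ∧ 2 * t * A ≤ N (z i - z j) := by
    intro i j hij
    rcases hij.lt_or_gt with h | h
    · exact hz i j h
    · rw [add_comm, map_sub_rev]
      exact hz j i h
  have hsA : 0 < s * A := mul_pos hs hA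
  let c : 𝕜 := ((s * A)⁻¹ : ℝ)
  have hc : ‖c‖ = (s * A)⁻¹ := by
    rw [RCLike.norm_ofReal, abs_of_pos (inv_pos.2 hsA)]
  have hscale : 2 * t / s = (s * A)⁻¹ * (2 * t * A) := by field_simp
  refine ⟨fun j => c • z j, fun j => ?_, fun i j hij => ?_⟩
  · rw [map_smul_eq_mul, hc, inv_mul_le_iff₀ hsA, mul_one]
    exact (hlt (p j)).le
  · rw [← smul_add, ← smul_sub, map_smul_eq_mul, map_smul_eq_mul, hc, hscale]
    have := inv_nonneg.2 hsA.le
    exact ⟨mul_le_mul_of_nonneg_left (hz' i j hij).1 this,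
      mul_le_mul_of_nonneg_left (hz' i j hij).2 this⟩

end Blocks

theorem mainTheorem9 {𝕜 : Type*} [RCLike 𝕜]
    {X : Type*} [NormedAddCommGroup X] [NormedSpace 𝕜 X] [CompleteSpace X]
    {F : Type*} [NormedAddCommGroup F] [NormedSpace 𝕜 F] [CompleteSpace F]
    (hF : IsSpreadingModel 𝕜 X F)
    (hℓ : Nonempty (F ≃L[𝕜] lp (fun _ : ℕ => 𝕜) 1))
    (N : Seminorm 𝕜 X) (hN : IsRenorming N) :
    symmKottmanConstant N = 2 := by
  obtain ⟨y, e, h⟩ := hF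
  obtain ⟨T⟩ := hℓ
  obtain ⟨c, C, hc, hC, hNc⟩ := hN
  obtain ⟨δ₀, hδ₀, hlow⟩ := h.exists_lower_estimate T
  obtain ⟨B, hB⟩ := h.isBounded.exists_norm_le
  set S : Set ℝ := {t | IsLowerSpreadConstant N y t} with hS
  -- Halving makes the estimate strict, so it passes from the limit to late tuples.
  have hmem : c * (δ₀ / 2) ∈ S := by
    intro k α
    rcases (Finset.sum_nonneg fun i (_ : i ∈ Finset.univ) => norm_nonneg (α i)).eq_or_lt with
      h0 | h0
    · rw [← h0, mul_zero]
      exact Eventually.of_forall fun n => apply_nonneg N _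
    · have hlt : δ₀ / 2 * ∑ i, ‖α i‖ < ‖∑ i : Fin k, α i • e i‖ :=
        (mul_lt_mul_of_pos_right (half_lt_self hδ₀) h0).trans_le (hlow k α)
      filter_upwards [(h.tendsto_norm k α).eventually (lt_mem_nhds hlt)] with n hn
      rw [mul_assoc]
      exact (mul_le_mul_of_nonneg_left hn.le hc.le).trans (hNc _).1
  have hbdd : BddAbove S := by
    refine ⟨C * B, fun t ht => ?_⟩
    obtain ⟨n, hn⟩ := (ht 1 fun _ => 1).exists
    simp only [Fin.sum_univ_one, norm_one, mul_one, one_smul] at hn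
    exact hn.trans ((hNc _).2.trans (mul_le_mul_of_nonneg_left (hB _ ⟨_, rfl⟩) hC.le))
  set δ := sSup S
  have hδ : 0 < δ := (mul_pos hc (half_pos hδ₀)).trans_le (le_csSup hbdd hmem)
  have hle : ∀ σ ∈ {σ : ℝ | 0 < σ ∧ ∃ x : ℕ → X, (∀ n, N (x n) ≤ 1) ∧
      ∀ n k, n ≠ k → σ ≤ N (x n + x k) ∧ σ ≤ N (x n - x k)}, σ ≤ 2 := by
    rintro σ ⟨-, x, hx, hsep⟩
    have := (hsep 0 1 zero_ne_one).1.trans (map_add_le_add N _ _)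
    linarith [hx 0, hx 1]
  have hge : ∀ σ, 0 < σ → σ < 2 → ∃ x : ℕ → X, (∀ n, N (x n) ≤ 1) ∧
      ∀ n k, n ≠ k → σ ≤ N (x n + x k) ∧ σ ≤ N (x n - x k) := by
    intro σ hσ hσ2
    -- By AM-GM `r² ≥ σ/2`, so `t > rδ` and `s = δ/r` give `2t/s ≥ σ`.
    set r : ℝ := (1 + σ / 2) / 2 with hr
    have hr0 : 0 < r := by positivity
    have hr1 : r < 1 := by rw [hr]; linarith
    obtain ⟨t, htS, ht⟩ := exists_lt_of_lt_csSup ⟨_, hmem⟩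
      (show r * δ < sSup S from mul_lt_of_lt_one_left hδ hr1)
    have hs : δ < δ / r := (lt_div_iff₀ hr0).2 (mul_lt_of_lt_one_right hδ hr1)
    obtain ⟨x, hx, hsep⟩ := exists_separated_of_isLowerSpreadConstant (hδ.trans hs) htS
      (fun hmem' => hs.not_ge (le_csSup hbdd hmem'))
    have hσle : σ ≤ 2 * t / (δ / r) := by
      rw [le_div_iff₀ (hδ.trans hs), ← mul_div_assoc, div_le_iff₀ hr0]
      have h1 : σ ≤ 2 * (r * r) := by nlinarith [sq_nonneg (r - 1)]
      calc σ * δ ≤ 2 * (r * r) * δ := mul_le_mul_of_nonneg_right h1 hδ.le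
        _ = 2 * (r * δ) * r := by ring
        _ ≤ 2 * t * r := by gcongr
    exact ⟨x, hx, fun n k hnk => ⟨hσle.trans (hsep n k hnk).1, hσle.trans (hsep n k hnk).2⟩⟩
  refine le_antisymm (csSup_le ⟨1, one_pos, hge 1 one_pos one_lt_two⟩ hle) ?_
  refine le_of_forall_lt_imp_le_of_dense fun σ hσ => ?_
  -- Here `σ` may be nonpositive; the maximum restores positivity.
  have hm : max σ 1 < 2 := max_lt hσ one_lt_two
  exact (le_max_left σ 1).trans (le_csSup ⟨2, hle⟩
    ⟨lt_max_of_lt_right one_pos, hge _ (lt_max_of_lt_right one_pos) hm⟩)
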